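/- Let $P$ be a probability measure. A user at a fixed point $u\in\mathbb R^2$ is served by a remote radio head (RRH) $\mathrm R_m$ at distance $d_m>0$ from $u$; the other RRHs $(\mathrm R_j)_{j\neq m}$ form a homogeneous Poisson point process of density $\lambda_{\mathrm R}>0$ on $\mathbb R^2$. Write $d_j$ for the distance from $\mathrm R_j$ to $u$. The channel coefficients $h_m,(h_j)_{j\ne m}$ are i.i.d. $\mathcal{CN}(0,1)$ (Rayleigh fading) and independent of the locations. With path loss exponent $\beta>2$, $\rho>0$ and noise power $\sigma^2\ge 0$, the SINR of the user is $$\gamma=\frac{\rho\, d_m^{-\beta}|h_m|^2}{\mathcal I+\sigma^2},\qquad \mathcal I=\sum_{j\ne m}\rho\, d_j^{-\beta}|h_j|^2 .$$ For $\mu,\theta,W,T>0$ and $\bar T=T/\ln 2$, the effective capacity of the user is $$E(\theta,d_m)=-\frac{1}{\theta W\bar T}\ln\mathbb E\big[(1+\gamma)^{-\mu\theta W\bar T}\big].$$ Let $N\ge1$ and $0=\gamma_1<\dots<\gamma_{N+1}=\gamma_{\max}<\infty$, let $I_n=[\gamma_n,\gamma_{n+1})$, and let $\bar\gamma_n\in[\gamma_n,\gamma_{n+1}]$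 be a typical value of $I_n$ (for instance its midpoint). The quantized effective capacity is $$E^{q}(\theta,d_m)=-\frac{1}{\theta W\bar T}\ln\mathbb E\Big[\sum_{n=1}^N\mathbf 1\{\gamma\in I_n\}(1+\bar\gamma_n)^{-\mu\theta W\bar T}\Big].$$ Put $A(\beta)=\frac1\beta\Gamma(\frac2\beta)\Gamma(1-\frac2\beta)$. Then: 1. Almost surely $0<\mathcal I<\infty$, the SINR $\gamma$ is measurable, and for every $x\ge 0$ $$P\{\gamma<x\}=1-\exp\Big(-2\pi A(\beta)x^{2/\beta}\lambda_{\mathrm R}d_m^2-\frac{x\,d_m^\beta\sigma^2}{\rho}\Big).$$ 2. For all quantization levels and typical values as above, $$\mathbb E\Big[\sum_{n=1}^N\mathbf 1\{\gamma\in I_n\}(1+\bar\gamma_n)^{-\mu\theta W\bar T}\Big]=\sum_{n=1}^N\big(P\{\gamma<\gamma_{n+1}\}-P\{\gamma<\gamma_n\}\big)(1+\bar\gamma_n)^{-\mu\theta W\bar T},$$ and $$E^{q}(\theta,d_m)=-\frac{1}{\theta W\bar T}\ln\mathcal G(\theta,d_m),$$ where $$\mathcal G(\theta,d_m)=\sum_{n=1}^N\Big(e^{-2\pi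 A(\beta)\gamma_n^{2/\beta}\lambda_{\mathrm R}d_m^2-\gamma_nd_m^\beta\sigma^2/\rho}-e^{-2\pi A(\beta)\gamma_{n+1}^{2/\beta}\lambda_{\mathrm R}d_m^2-\gamma_{n+1}d_m^\beta\sigma^2/\rho}\Big)(1+\bar\gamma_n)^{-\mu\theta W\bar T}>0.$$ 3. The right-hand side approximates the effective capacity: for every $\varepsilon>0$ there are $\delta>0$ and $M$ such that $\big|-\frac{1}{\theta W\bar T}\ln\mathcal G(\theta,d_m)-E(\theta,d_m)\big|<\varepsilon$ whenever $\max_n(\gamma_{n+1}-\gamma_n)\le\delta$ and $\gamma_{\max}\ge M$. -/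

import Mathlib

open MeasureTheory ProbabilityTheory
open scoped NNReal ENNReal

noncomputable section

namespace CRAN

/-- The Euclidean plane in which users and RRHs live. -/
abbrev Plane : Type := EuclideanSpace ℝ (Fin 2)

/-- The circularly symmetric complex normal law `CN(0,1)`: independent real and imaginary parts,
each with law `N(0,1/2)`. -/
def stdComplexNormal : Measure ℂ :=
  ((gaussianReal 0 (1 / 2)).prod (gaussianReal 0 (1 / 2))).map Complex.measurableEquivRealProd.symm

/-- Number of points of the configuration `(X j ω)_j` that lie in `B`. -/
def pointCount {ι Ω : Type*} (X : ι → Ω → Plane) (B : Set Plane) (ω : Ω) : ℕ∞ :=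
  {j | X j ω ∈ B}.encard

/-- `(X j)_j` is (an enumeration of) a homogeneous Poisson point process on the plane with density
`lam`: the number of points in a Borel set `B` of finite area is Poisson with mean `lam * |B|`,
and the numbers of points in finitely many disjoint such sets are independent. -/
structure IsHomogeneousPPP {ι Ω : Type*} [MeasurableSpace Ω] (P : Measure Ω) (lam : ℝ≥0)
    (X : ι → Ω → Plane) : Prop where
  measurable : ∀ j, Measurable (X j)
  poisson : ∀ B : Set Plane, MeasurableSet B → volume B ≠ ∞ → ∀ k : ℕ,
    P {ω | pointCount X B ω = k} = poissonMeasure (lam * (volume B).toNNReal) {k}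
  indep : ∀ (n : ℕ) (B : Fin n → Set Plane), (∀ i, MeasurableSet (B i)) →
    (∀ i, volume (B i) ≠ ∞) → (∀ i j, i ≠ j → Disjoint (B i) (B j)) → ∀ k : Fin n → ℕ,
    P {ω | ∀ i, pointCount X (B i) ω = k i} = ∏ i, P {ω | pointCount X (B i) ω = k i}

/-- The downlink model seen from a user at `u` served by the RRH with index `m`: `R j` is the
location of the `j`-th RRH, `h j` the channel coefficient of its link to the user. The serving RRH
is at distance `d` from the user, the other RRHs form a homogeneous PPP of density `lam`, the
channel coefficients are i.i.d. `CN(0,1)` (Rayleigh fading) and independent of the locations. -/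
structure IsRRHNetwork {ι Ω : Type*} [MeasurableSpace Ω] (P : Measure Ω) (lam : ℝ≥0) (d : ℝ)
    (u : Plane) (m : ι) (R : ι → Ω → Plane) (h : ι → Ω → ℂ) : Prop where
  measurable_location : ∀ j, Measurable (R j)
  serving_dist : ∀ ω, dist (R m ω) u = d
  others_ppp : IsHomogeneousPPP P lam (fun j : {j : ι // j ≠ m} => R j)
  measurable_fading : ∀ j, Measurable (h j)
  fading_law : ∀ j, P.map (h j) = stdComplexNormal
  fading_indep : iIndepFun h P
  fading_indep_location : IndepFun (fun ω j => h j ω) (fun ω j => R j ω) P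

/-- Power received at `u` over a link: `ρ d_j ^ (-β) |h_j|²`. -/
def receivedPower {ι Ω : Type*} (ρ β : ℝ) (u : Plane) (R : ι → Ω → Plane) (h : ι → Ω → ℂ)
    (j : ι) (ω : Ω) : ℝ :=
  ρ * dist (R j ω) u ^ (-β) * ‖h j ω‖ ^ 2

/-- Co-channel interference: the total power received from all RRHs other than the serving one
(a sum of nonnegative terms, hence always meaningful in `[0, ∞]`). -/
def interference {ι Ω : Type*} (ρ β : ℝ) (u : Plane) (m : ι) (R : ι → Ω → Plane)
    (h : ι → Ω → ℂ) (ω : Ω) : ℝ≥0∞ :=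
  ∑' j : {j : ι // j ≠ m}, ENNReal.ofReal (receivedPower ρ β u R h j ω)

/-- The receive SINR: useful power divided by interference plus noise power `σ²`. -/
def sinr {ι Ω : Type*} (ρ β σ : ℝ) (u : Plane) (m : ι) (R : ι → Ω → Plane)
    (h : ι → Ω → ℂ) (ω : Ω) : ℝ :=
  (ENNReal.ofReal (receivedPower ρ β u R h m ω) /
    (interference ρ β u m R h ω + ENNReal.ofReal (σ ^ 2))).toReal

/-- `T̄ = T / ln 2`. -/
def Tbar (T : ℝ) : ℝ := T / Real.log 2

/-- Effective capacity of a block-fading link with SINR `γ`: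
`E(θ) = -(1/(θ W T̄)) ln 𝔼[(1+γ)^(-μ θ W T̄)]`. -/
def effectiveCapacity {Ω : Type*} [MeasurableSpace Ω] (P : Measure Ω) (μ θ W T : ℝ)
    (γ : Ω → ℝ) : ℝ :=
  -(1 / (θ * W * Tbar T)) * Real.log (∫ ω, (1 + γ ω) ^ (-(μ * θ * W * Tbar T)) ∂P)

/-- A quantizer of the SINR range with `N` intervals `[level n, level (n+1))`, where
`0 = level 0 < ⋯ < level N`, and with a typical value for each interval. -/
structure SinrQuantizer (N : ℕ) where
  level : Fin (N + 1) → ℝ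
  level_zero : level 0 = 0
  level_strictMono : StrictMono level
  typical : Fin N → ℝ
  typical_mem : ∀ n, typical n ∈ Set.Icc (level n.castSucc) (level n.succ)

/-- The value of `(1+x)^(-a)` after quantization: `(1 + typical n)^(-a)` if `x` is in the `n`-th
interval, and no contribution if `x` is outside the quantized range. -/
def SinrQuantizer.quantizedPow {N : ℕ} (q : SinrQuantizer N) (a x : ℝ) : ℝ :=
  ∑ n : Fin N, (Set.Ico (q.level n.castSucc) (q.level n.succ)).indicator
    (fun _ => (1 + q.typical n) ^ (-a)) x

/-- Effective capacity computed with the quantized SINR. -/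
def quantizedEffectiveCapacity {Ω : Type*} [MeasurableSpace Ω] (P : Measure Ω) (μ θ W T : ℝ)
    {N : ℕ} (q : SinrQuantizer N) (γ : Ω → ℝ) : ℝ :=
  -(1 / (θ * W * Tbar T)) * Real.log (∫ ω, q.quantizedPow (μ * θ * W * Tbar T) (γ ω) ∂P)

/-- `A(β) = (1/β) Γ(2/β) Γ(1 - 2/β)`. -/
def A (β : ℝ) : ℝ := 1 / β * Real.Gamma (2 / β) * Real.Gamma (1 - 2 / β)

/-- `exp(-2π A(β) x^(2/β) λ d² - x d^β σ² / ρ)`. -/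
def coverage (ρ β σ lam d x : ℝ) : ℝ :=
  Real.exp (-2 * Real.pi * A β * x ^ (2 / β) * lam * d ^ 2 - x * d ^ β * σ ^ 2 / ρ)

/-- The closed-form sum `𝒢(θ, d)`. -/
def G {N : ℕ} (q : SinrQuantizer N) (ρ β σ lam μ W T θ d : ℝ) : ℝ :=
  ∑ n : Fin N,
    (coverage ρ β σ lam d (q.level n.castSucc) - coverage ρ β σ lam d (q.level n.succ)) *
      (1 + q.typical n) ^ (-(μ * θ * W * Tbar T))

end CRAN

end

/-! Write I for the interference. As |h_m|² is a unit exponential variable independent of I, one has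
P{γ ≥ x} = E[exp(-s(I + σ²))] with s = x d^β / ρ, so coverage reduces to the Laplace transform of I
(`measure_le_fading_sq`, `measure_le_sinr`).

To compute it, fix the locations: each interferer contributes an independent factor 1/(1 + sρ
d_j^(-β)) = exp(-log(1 + sρ d_j^(-β))) (`lintegral_expNeg_tsum_fading`). Averaging over the
locations is then the Laplace functional of the Poisson process (`IsHomogeneousPPP.laplace`), which
leaves the area integral of c/(c + |x|^β) with c = sρ. It equals 2π A(β) c^(2/β)
(`lintegral_plane_pathLoss`), and c^(2/β) = x^(2/β) d². Letting s tend to 0 and to ∞ in the same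
transform gives 0 < I < ∞ almost surely.

The quantized mean is a finite sum of differences of the distribution function of γ. It is close to
the true mean because y ↦ (1 + y)^(-a) is Lipschitz on [0, ∞) and tends to 0 at infinity; continuity
of the logarithm at the positive true mean finishes the proof.

Transforms are taken in [0, ∞] through `expNeg`, so no sum has to be known finite beforehand. -/

noncomputable section

namespace CRAN

open Filter Topology

/-! ### The exponential `expNeg` on [0, ∞]. -/

/-- The function `t ↦ exp (-t)` on `[0, ∞]`, with value `0` at `∞`. -/
def expNeg (t : ℝ≥0∞) : ℝ≥0∞ := EReal.exp (-(t : EReal))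

@[simp] lemma expNeg_zero : expNeg 0 = 1 := by simp [expNeg]

@[simp] lemma expNeg_top : expNeg ∞ = 0 := by simp [expNeg]

lemma expNeg_ofReal {x : ℝ} (hx : 0 ≤ x) :
    expNeg (ENNReal.ofReal x) = ENNReal.ofReal (Real.exp (-x)) := by
  rw [expNeg, EReal.coe_ennreal_ofReal, max_eq_left hx, ← EReal.coe_neg, EReal.exp_coe]

lemma expNeg_add (s t : ℝ≥0∞) : expNeg (s + t) = expNeg s * expNeg t := by
  rw [expNeg, expNeg, expNeg, EReal.coe_ennreal_add, EReal.neg_add, sub_eq_add_neg, EReal.exp_add]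
  · simp
  · simp

lemma expNeg_sum {κ : Type*} (s : Finset κ) (f : κ → ℝ≥0∞) :
    expNeg (∑ i ∈ s, f i) = ∏ i ∈ s, expNeg (f i) := by
  classical
  induction s using Finset.induction_on with
  | empty => simp
  | insert a s ha ih => rw [Finset.sum_insert ha, Finset.prod_insert ha, expNeg_add, ih]

lemma expNeg_natCast_mul (n : ℕ) (t : ℝ≥0∞) : expNeg (n * t) = expNeg t ^ n := by
  have := expNeg_sum (Finset.range n) (fun _ => t)
  simpa using this

lemma continuous_expNeg : Continuous expNeg :=
  ENNReal.continuous_exp.comp (continuous_neg.comp continuous_coe_ennreal_ereal)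

lemma measurable_expNeg : Measurable expNeg := continuous_expNeg.measurable

lemma antitone_expNeg : Antitone expNeg := fun _ _ h =>
  EReal.exp_monotone (EReal.neg_le_neg_iff.2 (EReal.coe_ennreal_le_coe_ennreal_iff.2 h))

lemma expNeg_le_one (t : ℝ≥0∞) : expNeg t ≤ 1 := by
  simpa using antitone_expNeg (zero_le (a := t))

lemma expNeg_ne_top (t : ℝ≥0∞) : expNeg t ≠ ∞ :=
  ((expNeg_le_one t).trans_lt ENNReal.one_lt_top).ne

/-- Probability generating function of the Poisson law. -/
lemma lintegral_expNeg_poissonMeasure (r : ℝ≥0) (a : ℝ≥0∞) :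
    ∫⁻ k : ℕ, expNeg (k * a) ∂(poissonMeasure r) = expNeg (r * (1 - expNeg a)) := by
  obtain ⟨z, hz⟩ : ∃ z : ℝ≥0, (z : ℝ≥0∞) = expNeg a := ⟨_, ENNReal.coe_toNNReal (expNeg_ne_top a)⟩
  have hz1 : z ≤ 1 := by
    have := expNeg_le_one a
    rw [← hz] at this
    exact_mod_cast this
  have hz1' : (z : ℝ) ≤ 1 := by exact_mod_cast hz1
  rw [lintegral_countable']
  simp_rw [expNeg_natCast_mul, poissonMeasure_singleton, ← hz]
  have h1 : (r : ℝ≥0∞) * (1 - z) = ENNReal.ofReal (r * (1 - z)) := by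
    rw [ENNReal.ofReal_mul r.coe_nonneg, ENNReal.ofReal_sub _ z.coe_nonneg]
    simp
  have h2 : HasSum (fun k : ℕ => (z : ℝ) ^ k * (Real.exp (-r) * r ^ k / k.factorial))
      (Real.exp (-(r * (1 - z)))) := by
    have := (NormedSpace.expSeries_div_hasSum_exp ((r : ℝ) * z)).mul_left (Real.exp (-r))
    rw [← Real.exp_eq_exp_ℝ, ← Real.exp_add] at this
    convert! this using 1
    · ext k
      rw [mul_pow]
      ring
    · congr 1
      ring
  rw [h1, expNeg_ofReal (by have := sub_nonneg.2 hz1'; positivity), ← h2.tsum_eq,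
    ENNReal.ofReal_tsum_of_nonneg (fun k => by positivity) h2.summable]
  congr 1
  ext k
  rw [ENNReal.ofReal_mul (by positivity), ENNReal.ofReal_pow z.coe_nonneg, ENNReal.ofReal_coe_nnreal]

/-! ### Laplace functional of a homogeneous Poisson process. -/

section PoissonProcess

variable {ι Ω : Type*}

lemma tsum_indicator_const_eq_pointCount (X : ι → Ω → Plane) (B : Set Plane) (a : ℝ≥0∞) (ω : Ω) :
    ∑' j, B.indicator (fun _ => a) (X j ω) = (pointCount X B ω : ℝ≥0∞) * a := by
  have : ∀ j, B.indicator (fun _ => a) (X j ω) = {j | X j ω ∈ B}.indicator (fun _ => a) j := by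
    classical
    intro j
    simp only [Set.indicator_apply]
    rfl
  rw [tsum_congr this, ← tsum_subtype, ENNReal.tsum_set_const, pointCount]

variable [MeasurableSpace Ω]

lemma measurable_pointCount [Countable ι] {X : ι → Ω → Plane} (hX : ∀ j, Measurable (X j))
    {B : Set Plane} (hB : MeasurableSet B) :
    Measurable (fun ω => (pointCount X B ω : ℝ≥0∞)) := by
  have : (fun ω => (pointCount X B ω : ℝ≥0∞)) =
      fun ω => ∑' j, B.indicator (fun _ => (1 : ℝ≥0∞)) (X j ω) := by
    ext ω
    rw [tsum_indicator_const_eq_pointCount, mul_one]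
  rw [this]
  exact Measurable.tsum fun j => (measurable_const.indicator hB).comp (hX j)

lemma measurableSet_pointCount_eq [Countable ι] {X : ι → Ω → Plane} (hX : ∀ j, Measurable (X j))
    {B : Set Plane} (hB : MeasurableSet B) (k : ℕ) :
    MeasurableSet {ω | pointCount X B ω = k} := by
  have : {ω | pointCount X B ω = k} = (fun ω => (pointCount X B ω : ℝ≥0∞)) ⁻¹' {(k : ℝ≥0∞)} := by
    ext ω
    simp only [Set.mem_ofPred_eq, Set.mem_preimage, Set.mem_singleton_iff]
    rw [← ENat.toENNReal_coe, ENat.toENNReal_inj]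
  rw [this]
  exact measurable_pointCount hX hB (measurableSet_singleton _)

variable {P : Measure Ω} [IsProbabilityMeasure P] {lam : ℝ≥0} {X : ι → Ω → Plane}

/-- The Poisson law has total mass 1 on the finite values, which leaves probability 0 for ⊤. -/
lemma IsHomogeneousPPP.ae_pointCount_ne_top [Countable ι] (hX : IsHomogeneousPPP P lam X)
    {B : Set Plane} (hB : MeasurableSet B) (hB' : volume B ≠ ∞) :
    ∀ᵐ ω ∂P, pointCount X B ω ≠ ⊤ := by
  have hm := measurableSet_pointCount_eq hX.measurable hB
  have h1 : P (⋃ k : ℕ, {ω | pointCount X B ω = k}) = 1 := by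
    rw [measure_iUnion _ hm]
    · simp_rw [hX.poisson B hB hB']
      have := measure_iUnion (μ := poissonMeasure (lam * (volume B).toNNReal))
        (f := fun k : ℕ => ({k} : Set ℕ)) (fun i j hij => by simpa using hij)
        (fun _ => measurableSet_singleton _)
      rw [← this, Set.iUnion_of_singleton, measure_univ]
    · intro i j hij
      refine Set.disjoint_left.2 fun ω hi hj => hij ?_
      simp only [Set.mem_ofPred_eq] at hi hj
      rw [hi] at hj
      exact_mod_cast hj
  have h2 := (prob_compl_eq_zero_iff (MeasurableSet.iUnion hm)).2 h1
  filter_upwards [measure_eq_zero_iff_ae_notMem.1 h2] with ω hω htop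
  simp [htop] at hω

/-- Laplace functional of a Poisson process on a step function. -/
lemma IsHomogeneousPPP.lintegral_expNeg_sum [Countable ι] (hX : IsHomogeneousPPP P lam X)
    {n : ℕ} (B : Fin n → Set Plane) (hB : ∀ i, MeasurableSet (B i))
    (hB' : ∀ i, volume (B i) ≠ ∞) (hd : ∀ i j, i ≠ j → Disjoint (B i) (B j))
    (a : Fin n → ℝ≥0∞) :
    ∫⁻ ω, expNeg (∑ i, pointCount X (B i) ω * a i) ∂P =
      expNeg (∑ i, lam * (volume (B i) * (1 - expNeg (a i)))) := by
  -- Counts as genuine ℕ-valued variables; `toNat` sends ⊤ to 0, which matters only on a null set.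
  set M : Fin n → Ω → ℕ := fun i ω => (pointCount X (B i) ω).toNat with hM
  have hae : ∀ᵐ ω ∂P, ∀ i, pointCount X (B i) ω = M i ω := by
    rw [ae_all_iff]
    intro i
    filter_upwards [hX.ae_pointCount_ne_top (hB i) (hB' i)] with ω hω
    exact (ENat.natCast_toNat hω).symm
  have hMm : ∀ i, Measurable (M i) := by
    intro i
    have : M i = fun ω => Nat.floor ((pointCount X (B i) ω : ℝ≥0∞).toReal) := by
      ext ω
      rcases eq_or_ne (pointCount X (B i) ω) ⊤ with h | h
      · simp [hM, h]
      · obtain ⟨k, hk⟩ := ENat.ne_top_iff_exists.1 h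
        simp [hM, ← hk]
    rw [this]
    exact (measurable_pointCount hX.measurable (hB i)).ennreal_toReal.nat_floor
  have hlaw1 : ∀ i (k : ℕ), P (M i ⁻¹' {k}) = P {ω | pointCount X (B i) ω = k} := by
    intro i k
    refine measure_congr ?_
    filter_upwards [hae] with ω hω
    refine propext (?_ : M i ω = k ↔ pointCount X (B i) ω = k)
    rw [hω i]
    exact_mod_cast Iff.rfl
  have hlaw : ∀ i, P.map (M i) = poissonMeasure (lam * (volume (B i)).toNNReal) := by
    intro i
    refine Measure.ext_of_singleton fun k => ?_
    rw [Measure.map_apply (hMm i) (measurableSet_singleton _), hlaw1, hX.poisson _ (hB i) (hB' i)]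
  -- On a countable space, factorization of the joint law at singletons is already independence.
  have hind : iIndepFun M P := by
    rw [iIndepFun_iff_map_fun_eq_pi_map fun i => (hMm i).aemeasurable]
    refine Measure.ext_of_singleton fun k => ?_
    have : ∀ i, IsProbabilityMeasure (P.map (M i)) := fun i =>
      Measure.isProbabilityMeasure_map (hMm i).aemeasurable
    rw [Measure.pi_singleton, Measure.map_apply (measurable_pi_lambda _ hMm)
      (measurableSet_singleton _)]
    simp_rw [Measure.map_apply (hMm _) (measurableSet_singleton _), hlaw1]
    rw [← hX.indep n B hB hB' hd k]
    refine measure_congr ?_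
    filter_upwards [hae] with ω hω
    refine propext (?_ : (fun i => M i ω) = k ↔ ∀ i, pointCount X (B i) ω = k i)
    rw [funext_iff]
    refine forall_congr' fun i => ?_
    rw [hω i]
    exact_mod_cast Iff.rfl
  have hcont : ∀ i, Measurable fun k : ℕ => expNeg (k * a i) := fun i => measurable_from_top
  calc ∫⁻ ω, expNeg (∑ i, pointCount X (B i) ω * a i) ∂P
      = ∫⁻ ω, ∏ i, expNeg (M i ω * a i) ∂P := by
        refine lintegral_congr_ae ?_
        filter_upwards [hae] with ω hω
        rw [expNeg_sum]
        refine Finset.prod_congr rfl fun i _ => ?_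
        rw [hω i, ENat.toENNReal_coe]
    _ = ∏ i, ∫⁻ ω, expNeg (M i ω * a i) ∂P :=
        lintegral_prod_eq_prod_lintegral_of_indepFun Finset.univ
          (fun i ω => expNeg (M i ω * a i)) (hind.comp (fun i k => expNeg (k * a i)) hcont)
          fun i => (hcont i).comp (hMm i)
    _ = _ := by
        rw [expNeg_sum]
        refine Finset.prod_congr rfl fun i _ => ?_
        have := lintegral_map (μ := P) (hcont i) (hMm i)
        rw [← this, hlaw, lintegral_expNeg_poissonMeasure, ENNReal.coe_mul,
          ENNReal.coe_toNNReal (hB' i), mul_assoc]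

/-- Laplace functional of a Poisson process on a simple function with support of finite area. -/
lemma IsHomogeneousPPP.laplace_simpleFunc [Countable ι] (hX : IsHomogeneousPPP P lam X)
    (g : SimpleFunc Plane ℝ≥0∞) (hg : volume (Function.support g) ≠ ∞) :
    ∫⁻ ω, expNeg (∑' j, g (X j ω)) ∂P = expNeg (lam * ∫⁻ x, (1 - expNeg (g x))) := by
  classical
  set s := g.range.filter (· ≠ 0) with hs
  set e := s.equivFin
  set a : Fin s.card → ℝ≥0∞ := fun i => (e.symm i : ℝ≥0∞)
  set B : Fin s.card → Set Plane := fun i => g ⁻¹' {a i}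
  have ha0 : ∀ i, a i ≠ 0 := fun i => (Finset.mem_filter.1 (e.symm i).2).2
  have hBm : ∀ i, MeasurableSet (B i) := fun i => g.measurableSet_fiber _
  -- Stated for any F vanishing at 0, because it serves twice: F = id for the sum over points and F
  -- = 1 - `expNeg` for the area integral.
  have hg_eq : ∀ (F : ℝ≥0∞ → ℝ≥0∞), F 0 = 0 → ∀ x,
      F (g x) = ∑ i, (B i).indicator (fun _ => F (a i)) x := by
    intro F hF x
    have h1 : ∑ i, (B i).indicator (fun _ => F (a i)) x =
        ∑ y ∈ s, (g ⁻¹' {y}).indicator (fun _ => F y) x := by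
      rw [← Finset.sum_coe_sort s]
      exact Fintype.sum_equiv e.symm _ _ fun i => rfl
    rw [h1]
    simp only [Set.indicator_apply, Set.mem_preimage, Set.mem_singleton_iff]
    rw [Finset.sum_ite_eq s (g x) F]
    split_ifs with h
    · rfl
    · have : g x = 0 := by
        by_contra h0
        exact h (Finset.mem_filter.2 ⟨g.mem_range_self x, h0⟩)
      rw [this, hF]
  have hB' : ∀ i, volume (B i) ≠ ∞ := fun i => by
    refine measure_ne_top_of_subset (fun x hx => ?_) hg
    rw [Function.mem_support, show g x = a i from hx]
    exact ha0 i
  have hd : ∀ i j, i ≠ j → Disjoint (B i) (B j) := by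
    intro i j hij
    refine Set.disjoint_left.2 fun x hi hj => hij ?_
    have : a i = a j := (show g x = a i from hi).symm.trans hj
    exact e.symm.injective (Subtype.ext this)
  have h1 : ∀ ω, ∑' j, g (X j ω) = ∑ i, pointCount X (B i) ω * a i := by
    intro ω
    simp_rw [← tsum_indicator_const_eq_pointCount]
    rw [tsum_congr fun j => show g (X j ω) = _ from hg_eq id rfl (X j ω),
      Summable.tsum_finsetSum fun i _ => ENNReal.summable]
    rfl
  have h2 : ∫⁻ x, (1 - expNeg (g x)) = ∑ i, volume (B i) * (1 - expNeg (a i)) := by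
    have := hg_eq (fun t => 1 - expNeg t) (by simp)
    rw [lintegral_congr this, lintegral_finsetSum _ fun i _ => measurable_const.indicator (hBm i)]
    refine Finset.sum_congr rfl fun i _ => ?_
    rw [lintegral_indicator_const (hBm i), mul_comm]
  simp_rw [h1]
  rw [h2, hX.lintegral_expNeg_sum B hBm hB' hd a, Finset.mul_sum]

/-- Laplace functional of a homogeneous Poisson process. -/
theorem IsHomogeneousPPP.laplace [Countable ι] (hX : IsHomogeneousPPP P lam X)
    {f : Plane → ℝ≥0∞} (hf : Measurable f) :
    ∫⁻ ω, expNeg (∑' j, f (X j ω)) ∂P = expNeg (lam * ∫⁻ x, (1 - expNeg (f x))) := by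
  -- Cutting off to the ball of radius n gives the finite-area support needed for the step-function
  -- case, while g n still increases to f.
  set g : ℕ → SimpleFunc Plane ℝ≥0∞ := fun n =>
    (SimpleFunc.eapprox f n).restrict (Metric.ball 0 n) with hg
  have hgx : ∀ n x, g n x = (Metric.ball (0 : Plane) n).indicator (SimpleFunc.eapprox f n) x :=
    fun n x => by rw [hg, SimpleFunc.restrict_apply _ measurableSet_ball]
  have hgsupp : ∀ n, volume (Function.support (g n)) ≠ ∞ := fun n => by
    refine measure_ne_top_of_subset (μ := volume) (s := Metric.ball (0 : Plane) n) (fun x hx => ?_)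
      measure_ball_lt_top.ne
    by_contra h
    exact hx (by rw [hgx, Set.indicator_of_notMem h])
  have hgmono : ∀ x, Monotone fun n => g n x := by
    intro x n k hnk
    simp only [hgx]
    calc (Metric.ball (0 : Plane) n).indicator (SimpleFunc.eapprox f n) x
        ≤ (Metric.ball (0 : Plane) n).indicator (SimpleFunc.eapprox f k) x :=
          Set.indicator_le_indicator (SimpleFunc.monotone_eapprox f hnk x)
      _ ≤ _ := Set.indicator_le_indicator_of_subset
          (Metric.ball_subset_ball (by exact_mod_cast hnk)) (fun _ => zero_le) x
  have hgsup : ∀ x, ⨆ n, g n x = f x := by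
    intro x
    rw [← SimpleFunc.iSup_eapprox_apply hf x]
    refine le_antisymm (iSup_mono fun n => ?_) (iSup_le fun n => ?_)
    · rw [hgx]
      exact Set.indicator_le_self _ _ _
    · obtain ⟨k, hk⟩ := exists_nat_gt ‖x‖
      refine le_iSup_of_le (max n k) ?_
      rw [hgx, Set.indicator_of_mem]
      · exact SimpleFunc.monotone_eapprox f (le_max_left n k) x
      · rw [mem_ball_zero_iff]
        exact hk.trans_le (by exact_mod_cast le_max_right n k)
  have hL : Tendsto (fun n => ∫⁻ ω, expNeg (∑' j, g n (X j ω)) ∂P) atTop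
      (𝓝 (∫⁻ ω, expNeg (∑' j, f (X j ω)) ∂P)) := by
    refine tendsto_lintegral_of_dominated_convergence (fun _ => 1) (fun n => ?_)
      (fun n => ae_of_all _ fun ω => expNeg_le_one _) (by simp) (ae_of_all _ fun ω => ?_)
    · exact measurable_expNeg.comp
        (Measurable.tsum fun j => (g n).measurable.comp (hX.measurable j))
    · refine (continuous_expNeg.tendsto _).comp ?_
      have h1 : ∑' j, f (X j ω) = ⨆ n, ∑' j, g n (X j ω) := by
        simp_rw [← hgsup]
        -- The sum is an integral against counting measure, so monotone convergence exchanges it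
        -- with the supremum.
        let _ : MeasurableSpace ι := ⊤
        simp_rw [← lintegral_count' measurable_from_top]
        exact lintegral_iSup (f := fun n j => g n (X j ω)) (fun n => measurable_from_top) fun n k hnk j => hgmono _ hnk
      rw [h1]
      exact tendsto_atTop_iSup fun n k hnk => ENNReal.tsum_le_tsum fun j => hgmono _ hnk
  have hR : Tendsto (fun n => expNeg (lam * ∫⁻ x, (1 - expNeg (g n x)))) atTop
      (𝓝 (expNeg (lam * ∫⁻ x, (1 - expNeg (f x))))) := by
    refine (continuous_expNeg.tendsto _).comp (ENNReal.Tendsto.const_mul ?_ (Or.inr (by simp)))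
    refine lintegral_tendsto_of_tendsto_of_monotone
      (fun n => (measurable_const.sub (measurable_expNeg.comp (g n).measurable)).aemeasurable)
      (ae_of_all _ fun x n k hnk => tsub_le_tsub_left (antitone_expNeg (hgmono x hnk)) _)
      (ae_of_all _ fun x => ?_)
    refine ENNReal.Tendsto.sub tendsto_const_nhds ?_ (Or.inl (by simp))
    refine (continuous_expNeg.tendsto _).comp ?_
    rw [← hgsup]
    exact tendsto_atTop_iSup (hgmono x)
  refine tendsto_nhds_unique hL ?_
  simp_rw [hX.laplace_simpleFunc _ (hgsupp _)]
  exact hR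

end PoissonProcess

/-! ### Rayleigh fading: |h|² is a unit exponential variable. -/

section Fading

lemma gaussianPDF_half_mul_gaussianPDF_half (z : ℂ) :
    gaussianPDF 0 (1 / 2) z.re * gaussianPDF 0 (1 / 2) z.im =
      ENNReal.ofReal (Real.exp (-‖z‖ ^ 2) / Real.pi) := by
  simp only [gaussianPDF_def]
  rw [← ENNReal.ofReal_mul (gaussianPDFReal_nonneg _ _ _)]
  congr 1
  simp only [gaussianPDFReal_def]
  have h2 : (2 * Real.pi * ((1 / 2 : ℝ≥0) : ℝ)) = Real.pi := by
    push_cast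
    ring
  have h3 : (2 * ((1 / 2 : ℝ≥0) : ℝ)) = 1 := by
    push_cast
    ring
  rw [h2, h3, mul_mul_mul_comm, ← Real.exp_add, ← mul_inv, Real.mul_self_sqrt Real.pi_pos.le,
    Complex.sq_norm, Complex.normSq_apply, div_eq_mul_inv, mul_comm]
  congr 2
  ring

instance : IsProbabilityMeasure stdComplexNormal :=
  Measure.isProbabilityMeasure_map Complex.measurableEquivRealProd.symm.measurable.aemeasurable

/-- The product of two N(0, 1/2) densities is the radial function exp(-|z|²)/π, so expectations
become Lebesgue integrals over ℂ. -/
lemma lintegral_stdComplexNormal {F : ℂ → ℝ≥0∞} (hF : Measurable F) :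
    ∫⁻ z, F z ∂stdComplexNormal = ∫⁻ z, ENNReal.ofReal (Real.exp (-‖z‖ ^ 2) / Real.pi) * F z := by
  have hv : (1 / 2 : ℝ≥0) ≠ 0 := by norm_num
  have hm := measurable_gaussianPDF 0 (1 / 2)
  have hF' := hF.comp Complex.measurableEquivRealProd.symm.measurable
  have hpdf : Measurable fun p : ℝ × ℝ => gaussianPDF 0 (1 / 2) p.1 * gaussianPDF 0 (1 / 2) p.2 :=
    (hm.comp measurable_fst).mul (hm.comp measurable_snd)
  have h1 := lintegral_withDensity_eq_lintegral_mul (volume.prod volume) hpdf hF'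
  have h2 := Complex.volume_preserving_equiv_real_prod.lintegral_comp_emb
    Complex.measurableEquivRealProd.measurableEmbedding
    (fun p => gaussianPDF 0 (1 / 2) p.1 * gaussianPDF 0 (1 / 2) p.2 *
      F (Complex.measurableEquivRealProd.symm p))
  rw [stdComplexNormal, lintegral_map hF Complex.measurableEquivRealProd.symm.measurable,
    gaussianReal_of_var_ne_zero 0 hv, prod_withDensity hm hm]
  refine (h1.trans h2.symm).trans (lintegral_congr fun z => ?_)
  rw [← gaussianPDF_half_mul_gaussianPDF_half, MeasurableEquiv.symm_apply_apply]
  rfl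

/-- `|h|²` is exponentially distributed for `h` with law `CN(0,1)`: Laplace transform. -/
lemma lintegral_expNeg_mul_sq_stdComplexNormal {c : ℝ} (hc : 0 ≤ c) :
    ∫⁻ z, expNeg (ENNReal.ofReal (c * ‖z‖ ^ 2)) ∂stdComplexNormal =
      expNeg (ENNReal.ofReal (Real.log (1 + c))) := by
  have hc1 : 0 < 1 + c := by linarith
  rw [lintegral_stdComplexNormal
    (F := fun z => expNeg (ENNReal.ofReal (c * ‖z‖ ^ 2))) (measurable_expNeg.comp (by fun_prop)),
    expNeg_ofReal (Real.log_nonneg (by linarith)), Real.exp_neg, Real.exp_log hc1]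
  have h1 : ∀ z : ℂ, ENNReal.ofReal (Real.exp (-‖z‖ ^ 2) / Real.pi) *
      expNeg (ENNReal.ofReal (c * ‖z‖ ^ 2)) =
      ENNReal.ofReal (Real.pi⁻¹ * Real.exp (-(1 + c) * ‖z‖ ^ 2)) := by
    intro z
    rw [expNeg_ofReal (by positivity), ← ENNReal.ofReal_mul (by positivity), div_mul_eq_mul_div,
      ← Real.exp_add, div_eq_inv_mul]
    congr 3
    ring
  have hint : ∫ z : ℂ, Real.exp (-(1 + c) * ‖z‖ ^ 2) = Real.pi / (1 + c) := by
    rw [GaussianFourier.integral_rexp_neg_mul_sq_norm hc1, Complex.finrank_real_complex]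
    norm_num
  -- A Bochner integral is 0 by default when the integrand is not integrable, so a nonzero value
  -- proves integrability.
  have hi : Integrable fun z : ℂ => Real.exp (-(1 + c) * ‖z‖ ^ 2) :=
    .of_integral_ne_zero (by rw [hint]; positivity)
  simp_rw [h1]
  rw [← ofReal_integral_eq_lintegral_ofReal (hi.const_mul _)
    (ae_of_all _ fun z => by positivity), integral_const_mul, hint]
  congr 1
  field_simp

lemma integral_Ioi_mul_exp_neg_sq (a : ℝ) (ha : 0 ≤ a) :
    ∫ r in Set.Ioi a, r * Real.exp (-r ^ 2) = Real.exp (-a ^ 2) / 2 := by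
  have := integral_Ioi_of_hasDerivAt_of_nonneg' (g := fun r => -Real.exp (-r ^ 2) / 2)
    (g' := fun r => r * Real.exp (-r ^ 2)) (a := a) (l := 0) ?_ ?_ ?_
  · rw [this]
    ring
  · intro x _
    have h1 : HasDerivAt (fun r : ℝ => -r ^ 2) (-(2 * x)) x := by
      convert! (hasDerivAt_pow 2 x).neg using 1
      simp
    convert! (h1.exp.neg.div_const 2) using 1
    ring
  · intro x hx
    have : 0 ≤ x := ha.trans hx.le
    positivity
  · have h1 : Tendsto (fun r : ℝ => Real.exp (-r ^ 2)) atTop (𝓝 0) :=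
      Real.tendsto_exp_neg_atTop_nhds_zero.comp (tendsto_pow_atTop two_ne_zero)
    simpa using h1.neg.div_const 2

/-- `|h|²` is exponentially distributed for `h` with law `CN(0,1)`: tail. -/
lemma stdComplexNormal_le_sq (t : ℝ≥0∞) :
    stdComplexNormal {z | t ≤ ENNReal.ofReal (‖z‖ ^ 2)} = expNeg t := by
  rcases eq_or_ne t ∞ with rfl | ht
  · simp
  lift t to ℝ≥0 using ht
  have hm : MeasurableSet {z : ℂ | (t : ℝ≥0∞) ≤ ENNReal.ofReal (‖z‖ ^ 2)} :=
    measurableSet_le measurable_const (by fun_prop)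
  rw [← lintegral_indicator_one hm, lintegral_stdComplexNormal (measurable_one.indicator hm)]
  set g : ℝ → ℝ := (Set.Ici √t).indicator fun r => Real.exp (-r ^ 2) with hg
  have h1 : ∀ z : ℂ, ENNReal.ofReal (Real.exp (-‖z‖ ^ 2) / Real.pi) *
      {z : ℂ | (t : ℝ≥0∞) ≤ ENNReal.ofReal (‖z‖ ^ 2)}.indicator 1 z =
      ENNReal.ofReal (Real.pi⁻¹ * g ‖z‖) := by
    intro z
    have hiff : (t : ℝ≥0∞) ≤ ENNReal.ofReal (‖z‖ ^ 2) ↔ √t ≤ ‖z‖ := by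
      rw [Real.sqrt_le_left (norm_nonneg z), ← ENNReal.ofReal_coe_nnreal,
        ENNReal.ofReal_le_ofReal_iff (by positivity)]
    by_cases h : √t ≤ ‖z‖
    · rw [Set.indicator_of_mem (show z ∈ {z : ℂ | (t : ℝ≥0∞) ≤ ENNReal.ofReal (‖z‖ ^ 2)} from hiff.2 h), hg, Set.indicator_of_mem (show ‖z‖ ∈ Set.Ici √t from h),
        div_eq_inv_mul]
      simp
    · rw [Set.indicator_of_notMem
        (show z ∉ {z : ℂ | (t : ℝ≥0∞) ≤ ENNReal.ofReal (‖z‖ ^ 2)} from fun h' => h (hiff.1 h')), hg,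
        Set.indicator_of_notMem (show ‖z‖ ∉ Set.Ici √t from h)]
      simp
  have hint : ∫ z : ℂ, g ‖z‖ = Real.pi * Real.exp (-t) := by
    rw [integral_fun_norm_addHaar, Complex.finrank_real_complex, measureReal_def,
      Complex.volume_ball]
    have h2 : ∀ y : ℝ, y ^ (2 - 1) • g y =
        (Set.Ici √t).indicator (fun r => r * Real.exp (-r ^ 2)) y := by
      intro y
      by_cases h : y ∈ Set.Ici √t
      · simp [hg, h]
      · simp [hg, h]
    simp_rw [h2]
    rw [setIntegral_indicator measurableSet_Ici]
    have h3 : (Set.Ioi (0 : ℝ) ∩ Set.Ici √t : Set ℝ) =ᵐ[volume] Set.Ioi √t := by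
      have : (Set.Ioi (0 : ℝ) ∩ Set.Ioi √t) = Set.Ioi √t := by
        rw [Set.Ioi_inter_Ioi, max_eq_right (Real.sqrt_nonneg _)]
      rw [← this]
      exact (ae_eq_refl _).inter Ioi_ae_eq_Ici.symm
    rw [setIntegral_congr_set h3, integral_Ioi_mul_exp_neg_sq _ (Real.sqrt_nonneg _),
      Real.sq_sqrt t.coe_nonneg]
    simp
    ring
  have hi : Integrable fun z : ℂ => g ‖z‖ :=
    .of_integral_ne_zero (by rw [hint]; positivity)
  have hg0 : ∀ r, 0 ≤ g r := fun r => Set.indicator_nonneg (fun _ _ => (Real.exp_pos _).le) _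
  rw [lintegral_congr h1, ← ofReal_integral_eq_lintegral_ofReal (hi.const_mul _)
    (ae_of_all _ fun z => mul_nonneg (by positivity) (hg0 _)), integral_const_mul, hint,
    ← ENNReal.ofReal_coe_nnreal, expNeg_ofReal t.coe_nonneg]
  congr 1
  field_simp

end Fading

/-! ### The area integral of the path loss. -/

section PathLoss

lemma lintegral_plane_exp_neg_mul_rpow {β t : ℝ} (hβ : 0 < β) (ht : 0 < t) :
    ∫⁻ x : Plane, ENNReal.ofReal (Real.exp (-t * ‖x‖ ^ β)) =
      ENNReal.ofReal (2 * Real.pi * (1 / β * Real.Gamma (2 / β)) * t ^ (-(2 / β))) := by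
  have hint : ∫ x : Plane, Real.exp (-t * ‖x‖ ^ β) =
      2 * Real.pi * (1 / β * Real.Gamma (2 / β)) * t ^ (-(2 / β)) := by
    rw [integral_fun_norm_addHaar volume (fun r : ℝ => Real.exp (-t * r ^ β)),
      finrank_euclideanSpace_fin, measureReal_def, EuclideanSpace.volume_ball_fin_two]
    have := integral_rpow_mul_exp_neg_mul_rpow (q := 1) hβ (by norm_num) ht
    simp only [Real.rpow_one] at this
    simp only [Nat.add_one_sub_one, pow_one, smul_eq_mul, this]
    norm_num [Real.pi_pos.le, neg_div]
    ring
  have hpos : 0 < Real.Gamma (2 / β) := Real.Gamma_pos_of_pos (by positivity)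
  have hi : Integrable fun x : Plane => Real.exp (-t * ‖x‖ ^ β) :=
    .of_integral_ne_zero (by rw [hint]; positivity)
  rw [← ofReal_integral_eq_lintegral_ofReal hi (ae_of_all _ fun z => by positivity), hint]

/-- With s = |x|^β this turns the path-loss integrand into a mixture of the functions exp(-t|x|^β),
whose plane integrals are Gamma values. -/
lemma ofReal_div_add_eq_lintegral {c s : ℝ} (hc : 0 < c) (hs : 0 ≤ s) :
    ENNReal.ofReal (c / (c + s)) =
      ∫⁻ t in Set.Ioi (0 : ℝ), ENNReal.ofReal (c * Real.exp (-t * c)) *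
        ENNReal.ofReal (Real.exp (-t * s)) := by
  have h1 : ∀ t : ℝ, ENNReal.ofReal (c * Real.exp (-t * c)) * ENNReal.ofReal (Real.exp (-t * s)) =
      ENNReal.ofReal (c * Real.exp (-(c + s) * t)) := by
    intro t
    rw [← ENNReal.ofReal_mul (by positivity), mul_assoc, ← Real.exp_add]
    congr 3
    ring
  have hint : ∫ t in Set.Ioi (0 : ℝ), Real.exp (-(c + s) * t) = 1 / (c + s) := by
    rw [integral_exp_mul_Ioi (by linarith), mul_zero, Real.exp_zero, neg_div_neg_eq]
  have hi : Integrable (fun t : ℝ => Real.exp (-(c + s) * t)) (volume.restrict (Set.Ioi 0)) :=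
    .of_integral_ne_zero (by rw [hint]; positivity)
  simp_rw [h1]
  rw [← ofReal_integral_eq_lintegral_ofReal (hi.const_mul _)
    (ae_of_all _ fun z => by positivity), integral_const_mul, hint]
  congr 1
  ring

/-- The area integral in the Laplace transform of the interference. -/
lemma lintegral_plane_pathLoss {β c : ℝ} (hβ : 2 < β) (hc : 0 < c) (u : Plane) :
    ∫⁻ x : Plane, (1 - expNeg (ENNReal.ofReal (Real.log (1 + c * dist x u ^ (-β))))) =
      ENNReal.ofReal (2 * Real.pi * A β * c ^ (2 / β)) := by
  have hβ0 : 0 < β := by linarith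
  have h2β : 2 / β < 1 := by rw [div_lt_one hβ0]; exact hβ
  have hΓ : 0 < Real.Gamma (2 / β) := Real.Gamma_pos_of_pos (by positivity)
  have hΓ' : 0 < Real.Gamma (1 - 2 / β) := Real.Gamma_pos_of_pos (by linarith)
  have h1 : ∀ᵐ x : Plane, 1 - expNeg (ENNReal.ofReal (Real.log (1 + c * dist x u ^ (-β)))) =
      ENNReal.ofReal (c / (c + ‖x - u‖ ^ β)) := by
    -- At x = u the power `0 ^ (-β)` takes the value 0, so the two integrands differ there, on a
    -- null set.
    have : ∀ᵐ x : Plane, x ≠ u := by simp [ae_iff]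
    filter_upwards [this] with x hx
    have hr : 0 < ‖x - u‖ := norm_pos_iff.2 (sub_ne_zero.2 hx)
    have hrβ : 0 < ‖x - u‖ ^ β := Real.rpow_pos_of_pos hr β
    have hpos : 0 < 1 + c * dist x u ^ (-β) := by positivity
    rw [expNeg_ofReal (Real.log_nonneg (by linarith [show 0 ≤ c * dist x u ^ (-β) by positivity])),
      Real.exp_neg, Real.exp_log hpos, ← ENNReal.ofReal_one,
      ← ENNReal.ofReal_sub _ (by positivity), dist_eq_norm, Real.rpow_neg hr.le]
    congr 1
    field_simp
    ring
  rw [lintegral_congr_ae h1, lintegral_sub_right_eq_self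
    (fun x : Plane => ENNReal.ofReal (c / (c + ‖x‖ ^ β))) u]
  have h2 : ∀ x : Plane, ENNReal.ofReal (c / (c + ‖x‖ ^ β)) =
      ∫⁻ t in Set.Ioi (0 : ℝ), ENNReal.ofReal (c * Real.exp (-t * c)) *
        ENNReal.ofReal (Real.exp (-t * ‖x‖ ^ β)) :=
    fun x => ofReal_div_add_eq_lintegral hc (by positivity)
  simp_rw [h2]
  -- By Tonelli, the plane integral comes first and yields t^(-2/β); the remaining t-integral is Γ(1
  -- - 2/β), convergent because β > 2.
  rw [lintegral_lintegral_swap (by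
    refine Measurable.aemeasurable ?_
    fun_prop)]
  set K : ℝ := 2 * Real.pi * (1 / β * Real.Gamma (2 / β)) with hK
  have hK0 : 0 < K := by positivity
  have h3 : ∫⁻ t in Set.Ioi (0 : ℝ), ∫⁻ x : Plane, ENNReal.ofReal (c * Real.exp (-t * c)) *
      ENNReal.ofReal (Real.exp (-t * ‖x‖ ^ β)) =
      ∫⁻ t in Set.Ioi (0 : ℝ), ENNReal.ofReal
        (K * c * (t ^ ((1 - 2 / β) - 1) * Real.exp (-(c * t)))) := by
    refine setLIntegral_congr_fun measurableSet_Ioi fun t ht => ?_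
    have ht : 0 < t := ht
    rw [lintegral_const_mul _ (by fun_prop), lintegral_plane_exp_neg_mul_rpow hβ0 ht,
      ← ENNReal.ofReal_mul (by positivity)]
    congr 1
    rw [show (1 - 2 / β) - 1 = -(2 / β) by ring, show -t * c = -(c * t) by ring]
    ring
  have hint := Real.integral_rpow_mul_exp_neg_mul_Ioi (a := 1 - 2 / β) (r := c) (by linarith) hc
  have hi : Integrable (fun t : ℝ => t ^ ((1 - 2 / β) - 1) * Real.exp (-(c * t)))
      (volume.restrict (Set.Ioi 0)) :=
    .of_integral_ne_zero (by rw [hint]; positivity)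
  rw [h3, ← ofReal_integral_eq_lintegral_ofReal (hi.const_mul _) ?_, integral_const_mul, hint]
  · congr 1
    rw [one_div c, Real.inv_rpow hc.le, ← Real.rpow_neg hc.le,
      show -(1 - 2 / β) = 2 / β - 1 by ring, Real.rpow_sub_one hc.ne', A, hK]
    field_simp
  · filter_upwards [ae_restrict_mem measurableSet_Ioi] with t ht
    have ht : 0 < t := ht
    simp only [Pi.zero_apply]
    positivity

end PathLoss

/-! ### Conditioning on independent variables. -/

section Independence

variable {Ω : Type*} [MeasurableSpace Ω] {P : Measure Ω} [IsProbabilityMeasure P]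

/-- Expectation of a function of two independent variables as an iterated expectation. -/
lemma lintegral_comp_of_indepFun {α γ : Type*} [MeasurableSpace α] [MeasurableSpace γ]
    {X : Ω → α} {Y : Ω → γ} (hXY : IndepFun X Y P) (hX : Measurable X) (hY : Measurable Y)
    {Φ : α × γ → ℝ≥0∞} (hΦ : Measurable Φ) :
    ∫⁻ ω, Φ (X ω, Y ω) ∂P = ∫⁻ ω', ∫⁻ ω, Φ (X ω, Y ω') ∂P ∂P := by
  have h1 := hXY.map_prod_eq_prod_map_map hX.aemeasurable hY.aemeasurable
  have : IsProbabilityMeasure (P.map X) := Measure.isProbabilityMeasure_map hX.aemeasurable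
  have : IsProbabilityMeasure (P.map Y) := Measure.isProbabilityMeasure_map hY.aemeasurable
  rw [← lintegral_map hΦ (hX.prodMk hY), h1, lintegral_prod_symm _ hΦ.aemeasurable,
    lintegral_map hΦ.lintegral_prod_left' hY]
  exact lintegral_congr fun ω' => lintegral_map (hΦ.comp measurable_prodMk_right) hX

-- The index sets {m} and its complement are disjoint, hence the σ-algebras they generate are
-- independent.
omit [IsProbabilityMeasure P] in
lemma indepFun_pi_ne_of_iIndepFun {ι α : Type*} [MeasurableSpace α] {h : ι → Ω → α}
    (hm : ∀ j, Measurable (h j)) (hind : iIndepFun h P) (m : ι) :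
    IndepFun (h m) (fun ω (j : {j // j ≠ m}) => h j ω) P := by
  have h1 : iIndep (fun j => MeasurableSpace.comap (h j) inferInstance) P := hind
  have h2 := indep_iSup_of_disjoint (fun j => (hm j).comap_le) h1
    (disjoint_compl_right (a := ({m} : Set ι)))
  refine (IndepFun_iff_Indep _ _ _).2 (indep_of_indep_of_le_left
    (indep_of_indep_of_le_right h2 ?_) ?_)
  · simp only [MeasurableSpace.pi, MeasurableSpace.comap_iSup, MeasurableSpace.comap_comp]
    refine iSup_le fun j => ?_
    exact le_iSup₂_of_le (j : ι) (show (j : ι) ∈ ({m} : Set ι)ᶜ from j.2) le_rfl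
  · exact le_iSup₂_of_le m (Set.mem_singleton m) le_rfl

/-- Laplace transform of a weighted sum of independent Rayleigh fading powers. -/
lemma lintegral_expNeg_tsum_fading {κ : Type*} [Countable κ] {H : κ → Ω → ℂ}
    (hH : ∀ j, Measurable (H j)) (hlaw : ∀ j, P.map (H j) = stdComplexNormal)
    (hind : iIndepFun H P) {c : κ → ℝ} (hc : ∀ j, 0 ≤ c j) :
    ∫⁻ ω, expNeg (∑' j, ENNReal.ofReal (c j * ‖H j ω‖ ^ 2)) ∂P =
      expNeg (∑' j, ENNReal.ofReal (Real.log (1 + c j))) := by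
  have hF : ∀ j, Measurable fun z : ℂ => expNeg (ENNReal.ofReal (c j * ‖z‖ ^ 2)) :=
    fun j => measurable_expNeg.comp (by fun_prop)
  have hfin : ∀ s : Finset κ, ∫⁻ ω, expNeg (∑ j ∈ s, ENNReal.ofReal (c j * ‖H j ω‖ ^ 2)) ∂P =
      expNeg (∑ j ∈ s, ENNReal.ofReal (Real.log (1 + c j))) := by
    intro s
    simp_rw [expNeg_sum]
    rw [lintegral_prod_eq_prod_lintegral_of_indepFun s
      (fun j ω => expNeg (ENNReal.ofReal (c j * ‖H j ω‖ ^ 2)))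
      (hind.comp (fun j z => expNeg (ENNReal.ofReal (c j * ‖z‖ ^ 2))) hF)
      fun j => (hF j).comp (hH j)]
    refine Finset.prod_congr rfl fun j _ => ?_
    rw [← lintegral_expNeg_mul_sq_stdComplexNormal (hc j), ← hlaw j, lintegral_map (hF j) (hH j)]
  have hL : Tendsto (fun s : Finset κ =>
      ∫⁻ ω, expNeg (∑ j ∈ s, ENNReal.ofReal (c j * ‖H j ω‖ ^ 2)) ∂P) atTop
      (𝓝 (∫⁻ ω, expNeg (∑' j, ENNReal.ofReal (c j * ‖H j ω‖ ^ 2)) ∂P)) := by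
    refine tendsto_lintegral_filter_of_dominated_convergence (fun _ => 1)
      (Eventually.of_forall fun s => ?_)
      (Eventually.of_forall fun s => ae_of_all _ fun ω => expNeg_le_one _) (by simp)
      (ae_of_all _ fun ω => (continuous_expNeg.tendsto _).comp ENNReal.summable.hasSum)
    refine measurable_expNeg.comp (Finset.measurable_fun_sum _ fun j _ => ?_)
    have := hH j
    fun_prop
  have hR : Tendsto (fun s : Finset κ => expNeg (∑ j ∈ s, ENNReal.ofReal (Real.log (1 + c j))))
      atTop (𝓝 (expNeg (∑' j, ENNReal.ofReal (Real.log (1 + c j))))) :=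
    (continuous_expNeg.tendsto _).comp ENNReal.summable.hasSum
  simp_rw [hfin] at hL
  exact tendsto_nhds_unique hL hR

end Independence

lemma A_pos {β : ℝ} (hβ : 2 < β) : 0 < A β := by
  have hβ0 : 0 < β := by linarith
  have h2β : 2 / β < 1 := by rw [div_lt_one hβ0]; exact hβ
  have hΓ : 0 < Real.Gamma (2 / β) := Real.Gamma_pos_of_pos (by positivity)
  have hΓ' : 0 < Real.Gamma (1 - 2 / β) := Real.Gamma_pos_of_pos (by linarith)
  rw [A]
  positivity

/-! ### Interference and the law of the SINR. -/

section Network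

variable {Ω ι : Type*} [MeasurableSpace Ω] [Countable ι] {P : Measure Ω} [IsProbabilityMeasure P]
  {lam : ℝ≥0} {ρ β σ d : ℝ} {u : Plane} {m : ι} {R : ι → Ω → Plane} {h : ι → Ω → ℂ}

omit [Countable ι] in
lemma measurable_receivedPower (hR : ∀ j, Measurable (R j)) (hh : ∀ j, Measurable (h j)) (j : ι) :
    Measurable (receivedPower ρ β u R h j) := by
  have := hR j
  have := hh j
  unfold receivedPower
  fun_prop

lemma measurable_interference (hR : ∀ j, Measurable (R j)) (hh : ∀ j, Measurable (h j)) :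
    Measurable (interference ρ β u m R h) :=
  Measurable.tsum fun j => (measurable_receivedPower hR hh j).ennreal_ofReal

lemma measurable_sinr (hR : ∀ j, Measurable (R j)) (hh : ∀ j, Measurable (h j)) :
    Measurable (sinr ρ β σ u m R h) :=
  ((measurable_receivedPower hR hh m).ennreal_ofReal.div
    ((measurable_interference hR hh).add measurable_const)).ennreal_toReal

/-- The interference as a function of the fading and the locations of the interferers. -/
def interferenceOf (ρ β : ℝ) (u : Plane) {κ : Type*} (p : (κ → ℂ) × (κ → Plane)) : ℝ≥0∞ :=
  ∑' j, ENNReal.ofReal (ρ * dist (p.2 j) u ^ (-β) * ‖p.1 j‖ ^ 2)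

lemma measurable_interferenceOf {κ : Type*} [Countable κ] :
    Measurable (interferenceOf ρ β u : (κ → ℂ) × (κ → Plane) → ℝ≥0∞) :=
  Measurable.tsum fun j => by fun_prop

namespace IsRRHNetwork

omit [Countable ι] [IsProbabilityMeasure P] in
lemma indepFun_interferers (hnet : IsRRHNetwork P lam d u m R h) :
    IndepFun (fun ω (j : {j // j ≠ m}) => h j ω) (fun ω (j : {j // j ≠ m}) => R j ω) P :=
  hnet.fading_indep_location.comp (φ := fun (x : ι → ℂ) (j : {j // j ≠ m}) => x j)
    (ψ := fun (x : ι → Plane) (j : {j // j ≠ m}) => x j) (by fun_prop) (by fun_prop)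

/-- Laplace transform of the interference. -/
theorem laplace_interference (hnet : IsRRHNetwork P lam d u m R h) (hρ : 0 < ρ) (hβ : 2 < β)
    {s : ℝ} (hs : 0 ≤ s) :
    ∫⁻ ω, expNeg (ENNReal.ofReal s * interference ρ β u m R h ω) ∂P =
      expNeg (ENNReal.ofReal (lam * (2 * Real.pi * A β * (s * ρ) ^ (2 / β)))) := by
  -- The case s = 0 is separate because the area integral was computed for a positive constant only.
  rcases hs.eq_or_lt with rfl | hs
  · have : 2 / β ≠ 0 := by positivity
    simp [Real.zero_rpow this]
  have hhm := measurable_pi_iff.2 fun j : {j // j ≠ m} => hnet.measurable_fading j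
  have hRm := measurable_pi_iff.2 fun j : {j // j ≠ m} => hnet.measurable_location j
  have h1 := lintegral_comp_of_indepFun hnet.indepFun_interferers hhm hRm
    (Φ := fun p => expNeg (ENNReal.ofReal s * interferenceOf ρ β u p))
    (measurable_expNeg.comp (measurable_interferenceOf.const_mul _))
  have h2 : ∀ ω', ∫⁻ ω, expNeg (ENNReal.ofReal s * interferenceOf ρ β u
      ((fun j : {j // j ≠ m} => h j ω), fun j : {j // j ≠ m} => R j ω')) ∂P =
      expNeg (∑' j : {j // j ≠ m},
        ENNReal.ofReal (Real.log (1 + s * ρ * dist (R j ω') u ^ (-β)))) := by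
    intro ω'
    rw [← lintegral_expNeg_tsum_fading (P := P) (fun j : {j // j ≠ m} => hnet.measurable_fading j)
      (fun j => hnet.fading_law j) (hnet.fading_indep.precomp Subtype.val_injective)
      (c := fun j => s * ρ * dist (R j ω') u ^ (-β)) (fun j => by positivity)]
    refine lintegral_congr fun ω => ?_
    rw [interferenceOf, ← ENNReal.tsum_mul_left]
    congr 1
    refine tsum_congr fun j => ?_
    rw [← ENNReal.ofReal_mul hs.le]
    congr 1
    ring
  refine h1.trans ?_
  simp_rw [h2]
  have hf : Measurable fun x : Plane =>
      ENNReal.ofReal (Real.log (1 + s * ρ * dist x u ^ (-β))) := by fun_prop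
  rw [hnet.others_ppp.laplace hf, lintegral_plane_pathLoss hβ (by positivity),
    ENNReal.ofReal_mul lam.coe_nonneg, ENNReal.ofReal_coe_nnreal]

/-- The exponent is K (sρ)^(2/β) with K > 0, which takes every positive value z as s varies; solving
for s gives the witness. -/
lemma exists_laplace_interference_eq (hnet : IsRRHNetwork P lam d u m R h) (hlam : 0 < lam)
    (hρ : 0 < ρ) (hβ : 2 < β) {z : ℝ} (hz : 0 < z) :
    ∃ s : ℝ, 0 < s ∧ ∫⁻ ω, expNeg (ENNReal.ofReal s * interference ρ β u m R h ω) ∂P =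
      ENNReal.ofReal (Real.exp (-z)) := by
  have hA := A_pos hβ
  have hβ0 : 0 < β := by linarith
  have hlam' : (0 : ℝ) < lam := hlam
  set K : ℝ := lam * (2 * Real.pi * A β) with hK
  have hK0 : 0 < K := by positivity
  refine ⟨(z / K) ^ (β / 2) / ρ, by positivity, ?_⟩
  rw [hnet.laplace_interference hρ hβ (by positivity), div_mul_cancel₀ _ hρ.ne',
    ← Real.rpow_mul (by positivity), show β / 2 * (2 / β) = 1 by field_simp, Real.rpow_one,
    ← mul_assoc, ← hK, mul_div_cancel₀ _ hK0.ne', expNeg_ofReal hz.le]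

theorem ae_interference_pos_lt_top (hnet : IsRRHNetwork P lam d u m R h) (hlam : 0 < lam)
    (hρ : 0 < ρ) (hβ : 2 < β) :
    ∀ᵐ ω ∂P, 0 < interference ρ β u m R h ω ∧ interference ρ β u m R h ω < ⊤ := by
  have hI : Measurable (interference ρ β u m R h) :=
    measurable_interference hnet.measurable_location hnet.measurable_fading
  -- The transform is at least P{I = 0} for every s, and it can be made as small as desired (z → ∞).
  have hzero : ∀ᵐ ω ∂P, interference ρ β u m R h ω ≠ 0 := by
    have hm : MeasurableSet {ω | interference ρ β u m R h ω = 0} := hI (measurableSet_singleton 0)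
    have hle : ∀ z : ℝ, 0 < z →
        P {ω | interference ρ β u m R h ω = 0} ≤ ENNReal.ofReal (Real.exp (-z)) := by
      intro z hz
      obtain ⟨s, -, hs⟩ := hnet.exists_laplace_interference_eq hlam hρ hβ hz
      rw [← hs, ← lintegral_indicator_one hm]
      refine lintegral_mono fun ω => ?_
      by_cases hω : interference ρ β u m R h ω = 0
      · simp [hω]
      · simp [hω]
    have hlim : Tendsto (fun z : ℝ => ENNReal.ofReal (Real.exp (-z))) atTop (𝓝 0) := by
      simpa using ENNReal.tendsto_ofReal Real.tendsto_exp_neg_atTop_nhds_zero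
    have := ge_of_tendsto hlim ((eventually_gt_atTop 0).mono hle)
    exact measure_eq_zero_iff_ae_notMem.1 (le_antisymm this zero_le)
  -- For s > 0 the transform vanishes where I = ∞, so it is at most P{I < ∞}; it tends to 1 as z →
  -- 0.
  have htop : ∀ᵐ ω ∂P, interference ρ β u m R h ω ≠ ⊤ := by
    have hm : MeasurableSet {ω | interference ρ β u m R h ω = ⊤} := hI (measurableSet_singleton ⊤)
    have hle : ∀ z : ℝ, 0 < z →
        ENNReal.ofReal (Real.exp (-z)) ≤ P {ω | interference ρ β u m R h ω = ⊤}ᶜ := by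
      intro z hz
      obtain ⟨s, hs0, hs⟩ := hnet.exists_laplace_interference_eq hlam hρ hβ hz
      rw [← hs, ← lintegral_indicator_one hm.compl]
      refine lintegral_mono fun ω => ?_
      by_cases hω : interference ρ β u m R h ω = ⊤
      · simp [hω, ENNReal.mul_top, hs0]
      · simpa [hω] using expNeg_le_one _
    have hlim : Tendsto (fun z : ℝ => ENNReal.ofReal (Real.exp (-z))) (𝓝[>] 0) (𝓝 1) := by
      have h0 : Tendsto (fun z : ℝ => Real.exp (-z)) (𝓝[>] 0) (𝓝 (Real.exp (-0))) :=
        ((Real.continuous_exp.comp continuous_neg).tendsto 0).mono_left nhdsWithin_le_nhds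
      simpa using ENNReal.tendsto_ofReal h0
    have := le_of_tendsto hlim (eventually_mem_nhdsWithin.mono hle)
    have h1 : P {ω | interference ρ β u m R h ω = ⊤}ᶜ = 1 := le_antisymm prob_le_one this
    exact measure_eq_zero_iff_ae_notMem.1 ((prob_compl_eq_one_iff hm).1 h1)
  filter_upwards [hzero, htop] with ω h0 h1
  exact ⟨pos_iff_ne_zero.2 h0, lt_top_iff_ne_top.2 h1⟩

omit [Countable ι] in
/-- Given the interference, the power of the useful link is exponentially distributed. -/
lemma measure_le_fading_sq (hnet : IsRRHNetwork P lam d u m R h)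
    {Ψ : ({j // j ≠ m} → ℂ) × ({j // j ≠ m} → Plane) → ℝ≥0∞} (hΨ : Measurable Ψ) :
    P {ω | Ψ ((fun j => h j ω), fun j => R j ω) ≤ ENNReal.ofReal (‖h m ω‖ ^ 2)} =
      ∫⁻ ω, expNeg (Ψ ((fun j => h j ω), fun j => R j ω)) ∂P := by
  have hhm := measurable_pi_iff.2 fun j : {j // j ≠ m} => hnet.measurable_fading j
  have hRm := measurable_pi_iff.2 fun j : {j // j ≠ m} => hnet.measurable_location j
  have hm := hnet.measurable_fading m
  have hind : IndepFun (fun ω => (h m ω, fun j : {j // j ≠ m} => h j ω))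
      (fun ω (j : {j // j ≠ m}) => R j ω) P :=
    hnet.fading_indep_location.comp
      (φ := fun x : ι → ℂ => (x m, fun j : {j // j ≠ m} => x j))
      (ψ := fun (x : ι → Plane) (j : {j // j ≠ m}) => x j) (by fun_prop) (by fun_prop)
  have hS : MeasurableSet {q : (ℂ × ({j // j ≠ m} → ℂ)) × ({j // j ≠ m} → Plane) |
      Ψ (q.1.2, q.2) ≤ ENNReal.ofReal (‖q.1.1‖ ^ 2)} :=
    measurableSet_le (hΨ.comp (by fun_prop)) (by fun_prop)
  -- Condition on the locations, then (`h3`) on the interferers' fading; what remains is the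
  -- exponential tail of |h_m|².
  have h1 := lintegral_comp_of_indepFun hind (hm.prodMk hhm) hRm (measurable_one.indicator hS)
  have h2 : ∀ y : {j // j ≠ m} → Plane,
      ∫⁻ ω, {q : (ℂ × ({j // j ≠ m} → ℂ)) × ({j // j ≠ m} → Plane) |
        Ψ (q.1.2, q.2) ≤ ENNReal.ofReal (‖q.1.1‖ ^ 2)}.indicator 1
          ((h m ω, fun j => h j ω), y) ∂P =
      ∫⁻ ω, expNeg (Ψ ((fun j => h j ω), y)) ∂P := by
    intro y
    have hT : MeasurableSet {p : ℂ × ({j // j ≠ m} → ℂ) |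
        Ψ (p.2, y) ≤ ENNReal.ofReal (‖p.1‖ ^ 2)} :=
      measurableSet_le (hΨ.comp (by fun_prop)) (by fun_prop)
    have h3 := lintegral_comp_of_indepFun
      (indepFun_pi_ne_of_iIndepFun hnet.measurable_fading hnet.fading_indep m) hm hhm
      (measurable_one.indicator hT)
    refine h3.trans (lintegral_congr fun ω' => ?_)
    rw [← stdComplexNormal_le_sq, ← hnet.fading_law m]
    have hU : MeasurableSet {z : ℂ | Ψ ((fun j : {j // j ≠ m} => h j ω'), y) ≤
        ENNReal.ofReal (‖z‖ ^ 2)} := measurableSet_le measurable_const (by fun_prop)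
    rw [Measure.map_apply hm hU, ← lintegral_indicator_one (hm hU)]
    rfl
  have h4 := lintegral_comp_of_indepFun hnet.indepFun_interferers hhm hRm
    (measurable_expNeg.comp hΨ)
  have hV : MeasurableSet {ω | Ψ ((fun j => h j ω), fun j => R j ω) ≤
      ENNReal.ofReal (‖h m ω‖ ^ 2)} :=
    measurableSet_le (hΨ.comp (hhm.prodMk hRm)) (by fun_prop)
  rw [← lintegral_indicator_one hV]
  refine h1.trans (Eq.trans ?_ h4.symm)
  exact lintegral_congr fun ω' => h2 _

/-- SINR coverage probability. -/
theorem measure_le_sinr (hnet : IsRRHNetwork P lam d u m R h) (hlam : 0 < lam) (hρ : 0 < ρ)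
    (hβ : 2 < β) (hd : 0 < d) {x : ℝ} (hx : 0 ≤ x) :
    P {ω | x ≤ sinr ρ β σ u m R h ω} = ENNReal.ofReal (coverage ρ β σ lam d x) := by
  have hβ0 : 0 < β := by linarith
  have hA := A_pos hβ
  set s : ℝ := x * d ^ β / ρ with hs
  have hs0 : 0 ≤ s := by positivity
  have hΨ : Measurable fun p : ({j // j ≠ m} → ℂ) × ({j // j ≠ m} → Plane) =>
      ENNReal.ofReal s * (interferenceOf ρ β u p + ENNReal.ofReal (σ ^ 2)) :=
    (measurable_interferenceOf.add_const _).const_mul _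
  have h1 : P {ω | x ≤ sinr ρ β σ u m R h ω} =
      P {ω | ENNReal.ofReal s * (interferenceOf ρ β u
        ((fun j : {j // j ≠ m} => h j ω), fun j : {j // j ≠ m} => R j ω) +
          ENNReal.ofReal (σ ^ 2)) ≤ ENNReal.ofReal (‖h m ω‖ ^ 2)} := by
    refine measure_congr ?_
    -- A nonzero finite denominator is required: otherwise division in [0, ∞] followed by `toReal`
    -- would not match the cleared inequality.
    filter_upwards [hnet.ae_interference_pos_lt_top hlam hρ hβ] with ω hω
    refine propext ?_
    change x ≤ sinr ρ β σ u m R h ω ↔ ENNReal.ofReal s *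
      (interference ρ β u m R h ω + ENNReal.ofReal (σ ^ 2)) ≤ ENNReal.ofReal (‖h m ω‖ ^ 2)
    set D := interference ρ β u m R h ω + ENNReal.ofReal (σ ^ 2)
    have hD0 : D ≠ 0 := (hω.1.trans_le le_self_add).ne'
    have hDt : D ≠ ⊤ := ENNReal.add_ne_top.2 ⟨hω.2.ne, ENNReal.ofReal_ne_top⟩
    set b : ℝ := ρ * d ^ (-β)
    have hb : 0 < b := by positivity
    have hsb : s = x / b := by
      simp only [hs, b, Real.rpow_neg hd.le]
      field_simp
    have hb0 : ENNReal.ofReal b ≠ 0 := by simpa using hb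
    rw [sinr, ← ENNReal.ofReal_le_iff_le_toReal (ENNReal.div_ne_top ENNReal.ofReal_ne_top hD0),
      ENNReal.le_div_iff_mul_le (Or.inl hD0) (Or.inl hDt), receivedPower, hnet.serving_dist,
      ENNReal.ofReal_mul hb.le, hsb, ENNReal.ofReal_div_of_pos hb, ← ENNReal.mul_div_right_comm,
      ENNReal.div_le_iff hb0 ENNReal.ofReal_ne_top, mul_comm (ENNReal.ofReal b)]
  rw [h1, hnet.measure_le_fading_sq hΨ]
  have h2 : ∀ ω, expNeg (ENNReal.ofReal s * (interferenceOf ρ β u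
      ((fun j : {j // j ≠ m} => h j ω), fun j : {j // j ≠ m} => R j ω) +
        ENNReal.ofReal (σ ^ 2))) =
      expNeg (ENNReal.ofReal s * interference ρ β u m R h ω) *
        expNeg (ENNReal.ofReal (s * σ ^ 2)) := by
    intro ω
    rw [mul_add, expNeg_add, ← ENNReal.ofReal_mul hs0]
    rfl
  simp_rw [h2]
  rw [lintegral_mul_const' _ _ (expNeg_ne_top _), hnet.laplace_interference hρ hβ hs0,
    ← expNeg_add, ← ENNReal.ofReal_add (by positivity) (by positivity),
    expNeg_ofReal (by positivity), coverage]
  have h3 : (s * ρ) ^ (2 / β) = x ^ (2 / β) * d ^ 2 := by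
    rw [hs, div_mul_cancel₀ _ hρ.ne', Real.mul_rpow hx (by positivity), ← Real.rpow_mul hd.le,
      mul_div_cancel₀ _ hβ0.ne', Real.rpow_two]
  rw [h3, hs]
  congr 2
  ring

/-- SINR outage probability. -/
theorem measureReal_sinr_lt (hnet : IsRRHNetwork P lam d u m R h) (hlam : 0 < lam) (hρ : 0 < ρ)
    (hβ : 2 < β) (hd : 0 < d) {x : ℝ} (hx : 0 ≤ x) :
    P.real {ω | sinr ρ β σ u m R h ω < x} = 1 - coverage ρ β σ lam d x := by
  have hm : MeasurableSet {ω | x ≤ sinr ρ β σ u m R h ω} := measurableSet_le measurable_const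
    (measurable_sinr hnet.measurable_location hnet.measurable_fading)
  have : {ω | sinr ρ β σ u m R h ω < x} = {ω | x ≤ sinr ρ β σ u m R h ω}ᶜ := by
    ext ω
    simp
  rw [this, probReal_compl_eq_one_sub hm, measureReal_def,
    hnet.measure_le_sinr hlam hρ hβ hd hx, ENNReal.toReal_ofReal (show 0 ≤ coverage ρ β σ lam d x from (Real.exp_pos _).le)]

end IsRRHNetwork

end Network

lemma coverage_strictAntiOn {lam ρ β σ d : ℝ} (hlam : 0 < lam) (hρ : 0 < ρ) (hβ : 2 < β)
    (hd : 0 < d) : StrictAntiOn (coverage ρ β σ lam d) (Set.Ici 0) := by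
  intro x hx y hy hxy
  have hx : 0 ≤ x := hx
  have hA := A_pos hβ
  have hβ0 : 0 < β := by linarith
  refine Real.exp_lt_exp.2 ?_
  have h1 : x ^ (2 / β) < y ^ (2 / β) := Real.rpow_lt_rpow hx hxy (by positivity)
  have hK : 0 < 2 * Real.pi * A β * lam * d ^ 2 := by positivity
  have h2 := mul_lt_mul_of_pos_left h1 hK
  have hL : 0 ≤ d ^ β * σ ^ 2 / ρ := by positivity
  have h3 := mul_le_mul_of_nonneg_left hxy.le hL
  have e1 : ∀ w, -2 * Real.pi * A β * w ^ (2 / β) * lam * d ^ 2 - w * d ^ β * σ ^ 2 / ρ =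
    -(2 * Real.pi * A β * lam * d ^ 2 * w ^ (2 / β)) - d ^ β * σ ^ 2 / ρ * w := fun w => by ring
  rw [e1, e1]
  linarith

/-! ### Pointwise error of the quantizer. -/

namespace SinrQuantizer

variable {N : ℕ} (q : SinrQuantizer N)

lemma level_nonneg (i : Fin (N + 1)) : 0 ≤ q.level i := by
  rw [← q.level_zero]
  exact q.level_strictMono.monotone (Fin.zero_le i)

lemma typical_nonneg (n : Fin N) : 0 ≤ q.typical n :=
  (q.level_nonneg _).trans (q.typical_mem n).1

lemma exists_mem_Ico {x : ℝ} (hx : 0 ≤ x) (hx' : x < q.level (Fin.last N)) :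
    ∃ n : Fin N, x ∈ Set.Ico (q.level n.castSucc) (q.level n.succ) := by
  by_contra! hcon
  have : ∀ i : Fin (N + 1), q.level i ≤ x := by
    intro i
    induction i using Fin.induction with
    | zero => rwa [q.level_zero]
    | succ n ih =>
      by_contra! hlt
      exact hcon n ⟨ih, hlt⟩
  exact (this _).not_gt hx'

lemma eq_of_mem_Ico {x : ℝ} {n k : Fin N}
    (hn : x ∈ Set.Ico (q.level n.castSucc) (q.level n.succ))
    (hk : x ∈ Set.Ico (q.level k.castSucc) (q.level k.succ)) : n = k := by
  have h1 := q.level_strictMono.lt_iff_lt.1 (hn.1.trans_lt hk.2)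
  have h2 := q.level_strictMono.lt_iff_lt.1 (hk.1.trans_lt hn.2)
  rw [Fin.castSucc_lt_succ_iff] at h1 h2
  exact le_antisymm h1 h2

lemma quantizedPow_of_mem_Ico {x : ℝ} {n : Fin N}
    (hn : x ∈ Set.Ico (q.level n.castSucc) (q.level n.succ)) (a : ℝ) :
    q.quantizedPow a x = (1 + q.typical n) ^ (-a) := by
  rw [quantizedPow, Finset.sum_eq_single n, Set.indicator_of_mem hn]
  · intro k _ hkn
    exact Set.indicator_of_notMem (fun hk => hkn (q.eq_of_mem_Ico hk hn)) _
  · simp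

lemma quantizedPow_of_last_le {x : ℝ} (hx : q.level (Fin.last N) ≤ x) (a : ℝ) :
    q.quantizedPow a x = 0 :=
  Finset.sum_eq_zero fun _ _ => Set.indicator_of_notMem
    (fun hn => (hn.2.trans_le ((q.level_strictMono.monotone (Fin.le_last _)).trans hx)).false) _

end SinrQuantizer

/-- Mean value inequality: the derivative -a(1 + z)^(-a-1) is at most a in absolute value on [0, ∞).
-/
lemma abs_one_add_rpow_neg_sub_le {a x y : ℝ} (ha : 0 ≤ a) (hx : 0 ≤ x) (hy : 0 ≤ y) :
    |(1 + y) ^ (-a) - (1 + x) ^ (-a)| ≤ a * |y - x| := by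
  have hder : ∀ z ∈ Set.Ici (0 : ℝ), HasDerivWithinAt (fun z : ℝ => (1 + z) ^ (-a))
      (1 * -a * (1 + z) ^ (-a - 1)) (Set.Ici 0) z := by
    intro z hz
    have hz : 0 ≤ z := hz
    exact (((hasDerivAt_id z).const_add 1).rpow_const
      (Or.inl (by simp only [id]; positivity))).hasDerivWithinAt
  refine (convex_Ici (0 : ℝ)).norm_image_sub_le_of_norm_hasDerivWithin_le hder (fun z hz => ?_)
    hx hy
  have hz : 0 ≤ z := hz
  have h1 : (1 + z) ^ (-a - 1) ≤ 1 := Real.rpow_le_one_of_one_le_of_nonpos (by linarith) (by linarith)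
  have h0 : 0 ≤ (1 + z) ^ (-a - 1) := by positivity
  rw [Real.norm_eq_abs, abs_mul, abs_of_nonneg h0, one_mul, abs_neg, abs_of_nonneg ha]
  exact mul_le_of_le_one_right ha h1

/-- Within the range, x and the typical value share an interval of length at most δ, which costs aδ.
Beyond it the quantized value is 0, and the loss (1 + x)^(-a) is at most (1 + M)^(-a). -/
lemma SinrQuantizer.abs_quantizedPow_sub_le {N : ℕ} (q : SinrQuantizer N) {a δ M x : ℝ}
    (ha : 0 ≤ a) (hδ0 : 0 ≤ δ) (hM0 : 0 ≤ M)
    (hδ : ∀ n : Fin N, q.level n.succ - q.level n.castSucc ≤ δ) (hM : M ≤ q.level (Fin.last N))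
    (hx : 0 ≤ x) :
    |q.quantizedPow a x - (1 + x) ^ (-a)| ≤ a * δ + (1 + M) ^ (-a) := by
  have h0 : 0 ≤ (1 + M) ^ (-a) := by positivity
  rcases lt_or_ge x (q.level (Fin.last N)) with hlt | hge
  · obtain ⟨n, hn⟩ := q.exists_mem_Ico hx hlt
    rw [q.quantizedPow_of_mem_Ico hn]
    refine (abs_one_add_rpow_neg_sub_le ha hx (q.typical_nonneg n)).trans ?_
    have ht := q.typical_mem n
    have h1 : |q.typical n - x| ≤ δ :=
      (abs_sub_le_of_le_of_le ht.1 ht.2 hn.1 hn.2.le).trans (hδ n)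
    have := mul_le_mul_of_nonneg_left h1 ha
    linarith
  · rw [q.quantizedPow_of_last_le hge, zero_sub, abs_neg, abs_of_nonneg (by positivity)]
    have h1 : (1 + x) ^ (-a) ≤ (1 + M) ^ (-a) :=
      Real.rpow_le_rpow_of_nonpos (by linarith) (by linarith) (by linarith)
    have := mul_nonneg ha hδ0
    linarith

/-! ### Expectations of the quantized power. -/

section Quantized

variable {Ω : Type*} [MeasurableSpace Ω] {P : Measure Ω} [IsProbabilityMeasure P] {γ : Ω → ℝ}

lemma SinrQuantizer.measurable_quantizedPow {N : ℕ} (q : SinrQuantizer N) (a : ℝ) :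
    Measurable (q.quantizedPow a) :=
  Finset.measurable_fun_sum _ fun _ _ => measurable_const.indicator measurableSet_Ico

lemma SinrQuantizer.integral_quantizedPow {N : ℕ} (q : SinrQuantizer N) (a : ℝ)
    (hγ : Measurable γ) :
    ∫ ω, q.quantizedPow a (γ ω) ∂P =
      ∑ n : Fin N, (P.real {ω | γ ω < q.level n.succ} - P.real {ω | γ ω < q.level n.castSucc}) *
        (1 + q.typical n) ^ (-a) := by
  have hS : ∀ n : Fin N, MeasurableSet (γ ⁻¹' Set.Ico (q.level n.castSucc) (q.level n.succ)) :=
    fun n => hγ measurableSet_Ico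
  have h1 : ∀ ω, q.quantizedPow a (γ ω) = ∑ n : Fin N,
      (γ ⁻¹' Set.Ico (q.level n.castSucc) (q.level n.succ)).indicator
        (fun _ => (1 + q.typical n) ^ (-a)) ω := fun ω => rfl
  simp_rw [h1]
  rw [integral_finsetSum _ fun n _ => (integrable_const _).indicator (hS n)]
  refine Finset.sum_congr rfl fun n _ => ?_
  -- The event {γ ∈ I_n} is the difference of two nested events {γ < level}.
  rw [integral_indicator_const _ (hS n), smul_eq_mul, ← measureReal_sdiff]
  · congr 2
    ext ω
    simp [and_comm]
  · intro ω hω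
    exact lt_trans hω (q.level_strictMono Fin.castSucc_lt_succ)
  · exact measurableSet_lt hγ measurable_const

lemma integrable_one_add_rpow_neg {a : ℝ} (ha : 0 ≤ a) (hγ : Measurable γ)
    (hγ0 : ∀ ω, 0 ≤ γ ω) : Integrable (fun ω => (1 + γ ω) ^ (-a)) P := by
  refine .of_bound (Measurable.aestronglyMeasurable (by fun_prop)) 1 (ae_of_all _ fun ω => ?_)
  have h0 := hγ0 ω
  rw [Real.norm_of_nonneg (by positivity)]
  exact Real.rpow_le_one_of_one_le_of_nonpos (by linarith) (by linarith)

lemma integral_one_add_rpow_neg_pos {a : ℝ} (ha : 0 ≤ a) (hγ : Measurable γ)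
    (hγ0 : ∀ ω, 0 ≤ γ ω) : 0 < ∫ ω, (1 + γ ω) ^ (-a) ∂P := by
  have hpos : ∀ ω, 0 < (1 + γ ω) ^ (-a) := fun ω => by
    have := hγ0 ω
    positivity
  rw [integral_pos_iff_support_of_nonneg (fun ω => (hpos ω).le)
    (integrable_one_add_rpow_neg ha hγ hγ0)]
  have : Function.support (fun ω => (1 + γ ω) ^ (-a)) = Set.univ :=
    Set.eq_univ_of_forall fun ω => (hpos ω).ne'
  rw [this, measure_univ]
  exact one_pos

lemma SinrQuantizer.abs_integral_quantizedPow_sub_le {N : ℕ} (q : SinrQuantizer N) {a δ M : ℝ}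
    (ha : 0 ≤ a) (hδ0 : 0 ≤ δ) (hM0 : 0 ≤ M)
    (hδ : ∀ n : Fin N, q.level n.succ - q.level n.castSucc ≤ δ) (hM : M ≤ q.level (Fin.last N))
    (hγ : Measurable γ) (hγ0 : ∀ ω, 0 ≤ γ ω) :
    |∫ ω, q.quantizedPow a (γ ω) ∂P - ∫ ω, (1 + γ ω) ^ (-a) ∂P| ≤ a * δ + (1 + M) ^ (-a) := by
  have hb := fun ω => q.abs_quantizedPow_sub_le ha hδ0 hM0 hδ hM (hγ0 ω)
  have hi := integrable_one_add_rpow_neg (P := P) ha hγ hγ0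
  have hd : Integrable (fun ω => q.quantizedPow a (γ ω) - (1 + γ ω) ^ (-a)) P :=
    .of_bound ((((q.measurable_quantizedPow a).comp hγ).sub
      (by fun_prop)).aestronglyMeasurable) _ (ae_of_all _ hb)
  have hq : Integrable (fun ω => q.quantizedPow a (γ ω)) P := by
    refine (hd.add hi).congr (ae_of_all _ fun ω => ?_)
    simp
  rw [← integral_sub hq hi]
  have := norm_integral_le_of_norm_le_const (μ := P)
    (f := fun ω => q.quantizedPow a (γ ω) - (1 + γ ω) ^ (-a)) (ae_of_all _ hb)
  simpa using this

end Quantized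

end CRAN

end

/-! ### The main theorem. -/

theorem theorem3 {Ω ι : Type*} [MeasurableSpace Ω] [Countable ι]
    (P : MeasureTheory.Measure Ω) [MeasureTheory.IsProbabilityMeasure P]
    (lam : NNReal) (hlam : 0 < lam)
    (ρ β σ d μ θ W T : ℝ) (hρ : 0 < ρ) (hβ : 2 < β) (hd : 0 < d)
    (hμ : 0 < μ) (hθ : 0 < θ) (hW : 0 < W) (hT : 0 < T)
    (u : CRAN.Plane) (m : ι) (R : ι → Ω → CRAN.Plane) (h : ι → Ω → ℂ)
    (hnet : CRAN.IsRRHNetwork P lam d u m R h) :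
    -- the SINR is almost surely a ratio of finite quantities with nonzero denominator
    (∀ᵐ ω ∂P, 0 < CRAN.interference ρ β u m R h ω ∧ CRAN.interference ρ β u m R h ω < ⊤) ∧
    Measurable (CRAN.sinr ρ β σ u m R h) ∧
    -- SINR outage probability
    (∀ x : ℝ, 0 ≤ x →
      P.real {ω | CRAN.sinr ρ β σ u m R h ω < x} = 1 - CRAN.coverage ρ β σ lam d x) ∧
    -- quantized mean and effective capacity, for every quantizer
    (∀ (N : ℕ) (q : CRAN.SinrQuantizer N), 0 < N →
      ∫ ω, q.quantizedPow (μ * θ * W * CRAN.Tbar T) (CRAN.sinr ρ β σ u m R h ω) ∂P =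
        ∑ n : Fin N,
          (P.real {ω | CRAN.sinr ρ β σ u m R h ω < q.level n.succ} -
            P.real {ω | CRAN.sinr ρ β σ u m R h ω < q.level n.castSucc}) *
          (1 + q.typical n) ^ (-(μ * θ * W * CRAN.Tbar T)) ∧
      0 < CRAN.G q ρ β σ lam μ W T θ d ∧
      CRAN.quantizedEffectiveCapacity P μ θ W T q (CRAN.sinr ρ β σ u m R h) =
        -(1 / (θ * W * CRAN.Tbar T)) * Real.log (CRAN.G q ρ β σ lam μ W T θ d)) ∧
    -- the closed form approximates the effective capacity: it converges to it
    -- as the intervals shrink and the quantized range grows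
    (∀ ε : ℝ, 0 < ε → ∃ δ : ℝ, 0 < δ ∧ ∃ M : ℝ, ∀ (N : ℕ) (q : CRAN.SinrQuantizer N),
      (∀ n : Fin N, q.level n.succ - q.level n.castSucc ≤ δ) → M ≤ q.level (Fin.last N) →
      |-(1 / (θ * W * CRAN.Tbar T)) * Real.log (CRAN.G q ρ β σ lam μ W T θ d) -
        CRAN.effectiveCapacity P μ θ W T (CRAN.sinr ρ β σ u m R h)| < ε) := by
  have hm : Measurable (CRAN.sinr ρ β σ u m R h) :=
    CRAN.measurable_sinr hnet.measurable_location hnet.measurable_fading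
  have h0 : ∀ ω, 0 ≤ CRAN.sinr ρ β σ u m R h ω := fun ω => ENNReal.toReal_nonneg
  have hout : ∀ x : ℝ, 0 ≤ x →
      P.real {ω | CRAN.sinr ρ β σ u m R h ω < x} = 1 - CRAN.coverage ρ β σ lam d x :=
    fun x hx => hnet.measureReal_sinr_lt hlam hρ hβ hd hx
  have hTbar : 0 < CRAN.Tbar T := div_pos hT (Real.log_pos one_lt_two)
  set a : ℝ := μ * θ * W * CRAN.Tbar T with ha
  have ha0 : 0 < a := by positivity
  have hG : ∀ (N : ℕ) (q : CRAN.SinrQuantizer N),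
      ∫ ω, q.quantizedPow a (CRAN.sinr ρ β σ u m R h ω) ∂P = CRAN.G q ρ β σ lam μ W T θ d := by
    intro N q
    rw [q.integral_quantizedPow a hm, CRAN.G]
    refine Finset.sum_congr rfl fun n _ => ?_
    rw [hout _ (q.level_nonneg _), hout _ (q.level_nonneg _), sub_sub_sub_cancel_left]
  refine ⟨hnet.ae_interference_pos_lt_top hlam hρ hβ, hm, hout, fun N q hN => ⟨?_, ?_, ?_⟩, ?_⟩
  · exact q.integral_quantizedPow a hm
  · have : Nonempty (Fin N) := ⟨⟨0, hN⟩⟩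
    refine Finset.sum_pos (fun n _ => mul_pos (sub_pos.2 ?_) ?_) Finset.univ_nonempty
    · exact CRAN.coverage_strictAntiOn (by exact_mod_cast hlam) hρ hβ hd (q.level_nonneg _)
        (q.level_nonneg _) (q.level_strictMono Fin.castSucc_lt_succ)
    · have := q.typical_nonneg n
      positivity
  · rw [CRAN.quantizedEffectiveCapacity, ← ha, hG]
  · intro ε hε
    set E := ∫ ω, (1 + CRAN.sinr ρ β σ u m R h ω) ^ (-a) ∂P with hE
    have hE0 : 0 < E := CRAN.integral_one_add_rpow_neg_pos ha0.le hm h0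
    have hcont : ContinuousAt (fun y => -(1 / (θ * W * CRAN.Tbar T)) * Real.log y) E :=
      (Real.continuousAt_log hE0.ne').const_mul _
    obtain ⟨η, hη, hlog⟩ := Metric.continuousAt_iff.1 hcont ε hε
    have hlim : Filter.Tendsto (fun M : ℝ => (1 + M) ^ (-a)) Filter.atTop (nhds 0) :=
      (tendsto_rpow_neg_atTop ha0).comp (Filter.tendsto_atTop_add_const_left _ 1 Filter.tendsto_id)
    -- The tolerance η on the mean is split in two: M makes the tail term less than η/2, and δ =
    -- η/(2a) makes the Lipschitz term aδ equal to η/2.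
    obtain ⟨M, hM0, hM⟩ := ((Filter.eventually_ge_atTop 0).and
      (hlim.eventually (gt_mem_nhds (half_pos hη)))).exists
    refine ⟨η / 2 / a, by positivity, M, fun N q hδ hlast => ?_⟩
    have hle := q.abs_integral_quantizedPow_sub_le (P := P) ha0.le (by positivity) hM0 hδ hlast hm h0
    rw [hG, mul_div_cancel₀ _ ha0.ne'] at hle
    exact hlog (show dist (CRAN.G q ρ β σ lam μ W T θ d) E < η from hle.trans_lt (by linarith))
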